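/- Let $\mathfrak H$, $\mathfrak H_A$, $\mathfrak H_B$ be complex Hilbert spaces. Let $A$ be a closed linear relation from $\mathfrak H$ to $\mathfrak H_A$ and $B$ a closed linear relation from $\mathfrak H$ to $\mathfrak H_B$, that is, closed linear subspaces $A\subset\mathfrak H\times\mathfrak H_A$ and $B\subset\mathfrak H\times\mathfrak H_B$. Then there exists a bounded everywhere defined linear operator $Z\in\mathbf B(\mathfrak H_B,\mathfrak H_A)$ such that $$ZB\subset A,\qquad\text{i.e. } \{f,Zf'\}\in A \text{ for all } \{f,f'\}\in B,$$ if and only if there exists $c\ge 0$ such that $$A^*A\le c^2B^*B .$$ Moreover, whenever the latter inequality holds for some $c\ge 0$, the operator $Z$ with $ZB\subset A$ can be chosen such that $\|Z\|\le c$. Here the adjoint of a relation $T$ from $\mathfrak H$ to $\mathfrak K$ is $T^*=\{\{g,h\}\in\mathfrak K\times\mathfrak H:\ (f',g)=(f,h)\text{ for all }\{f,f'\}\in T\}$; the product of $T$ with a relation $S$ from $\mathfrak K$ to $\mathfrak M$ is $ST=\{\{f,g\}:\ \{f,\varphi\}\in T,\ \{\varphi,g\}\in S\text{ for some }\varphi\in\mathfrak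 K\}$; and $aT=\{\{f,af'\}:\{f,f'\}\in T\}$ for $a\in\mathbb R$. A relation $H$ in $\mathfrak H$ is nonnegative selfadjoint if $H=H^*$ and $(f',f)\ge 0$ for all $\{f,f'\}\in H$; then $H^{1/2}$ denotes the unique nonnegative selfadjoint relation $K$ in $\mathfrak H$ with $K^2=H$, and $H^{1/2}_{\rm s}$ denotes its operator part, where $K_{\rm s}=\{\{f,f'\}\in K:\ f'\perp\varphi\text{ for all }\varphi\text{ with }\{0,\varphi\}\in K\}$. For relations $H_1$, $H_2$ in $\mathfrak H$, the inequality $H_1\le H_2$ means that $H_1$ and $H_2$ are nonnegative selfadjoint, that $\operatorname{dom}H_{2\rm s}^{1/2}\subset\operatorname{dom}H_{1\rm s}^{1/2}$, and that $\|H_{1\rm s}^{1/2}h\|\le\|H_{2\rm s}^{1/2}h\|$ for all $h\in\operatorname{dom}H_{2\rm s}^{1/2}$. -/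

import Mathlib

/-! Linear relations from a complex Hilbert space `E` to a complex Hilbert space `F` are linear
subspaces of `E × F`; the adjoint relation is Mathlib's `Submodule.adjoint`, i.e.
`(g, h) ∈ T.adjoint ↔ ∀ (a, b) ∈ T, ⟪b, g⟫ = ⟪a, h⟫`. -/

namespace LinRel

section Algebra

variable {E F G : Type*}
  [AddCommGroup E] [Module ℂ E] [AddCommGroup F] [Module ℂ F] [AddCommGroup G] [Module ℂ G]

/-- The domain of a linear relation. -/
def dom (T : Submodule ℂ (E × F)) : Submodule ℂ E := T.map (LinearMap.fst ℂ E F)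

/-- The multivalued part `{f' | (0, f') ∈ T}` of a linear relation. -/
def mul (T : Submodule ℂ (E × F)) : Submodule ℂ F := T.comap (LinearMap.inr ℂ E F)

/-- The product `S T = {(f, g) | (f, φ) ∈ T and (φ, g) ∈ S for some φ}`. -/
def prod (S : Submodule ℂ (F × G)) (T : Submodule ℂ (E × F)) : Submodule ℂ (E × G) where
  carrier := {p | ∃ φ : F, (p.1, φ) ∈ T ∧ (φ, p.2) ∈ S}
  zero_mem' := ⟨0, T.zero_mem, S.zero_mem⟩
  add_mem' := by
    rintro p q ⟨φ, h₁, h₂⟩ ⟨ψ, h₃, h₄⟩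
    exact ⟨φ + ψ, T.add_mem h₁ h₃, S.add_mem h₂ h₄⟩
  smul_mem' := by
    rintro a p ⟨φ, h₁, h₂⟩
    exact ⟨a • φ, T.smul_mem a h₁, S.smul_mem a h₂⟩

/-- The scalar multiple `a T = {(f, a f') | (f, f') ∈ T}`. -/
def scale (a : ℝ) (T : Submodule ℂ (E × F)) : Submodule ℂ (E × F) :=
  T.map (LinearMap.prodMap LinearMap.id ((a : ℂ) • LinearMap.id))

theorem mem_dom {T : Submodule ℂ (E × F)} {f : E} : f ∈ dom T ↔ ∃ f', (f, f') ∈ T := by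
  simp [dom]

theorem mem_mul {T : Submodule ℂ (E × F)} {f' : F} : f' ∈ mul T ↔ ((0 : E), f') ∈ T :=
  Iff.rfl

theorem mem_prod {S : Submodule ℂ (F × G)} {T : Submodule ℂ (E × F)} {f : E} {g : G} :
    (f, g) ∈ prod S T ↔ ∃ φ : F, (f, φ) ∈ T ∧ (φ, g) ∈ S :=
  Iff.rfl

theorem mem_scale {a : ℝ} {T : Submodule ℂ (E × F)} {f : E} {g : F} :
    (f, g) ∈ scale a T ↔ ∃ f', (f, f') ∈ T ∧ (a : ℂ) • f' = g := by
  simp [scale]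

end Algebra

section Hilbert

variable {E F : Type*} [NormedAddCommGroup E] [InnerProductSpace ℂ E]
  [NormedAddCommGroup F] [InnerProductSpace ℂ F]

/-- The operator part `T_s`: the orthogonal complement of `{0} × mul T` inside `T`, that is, the
set of all `(f, f') ∈ T` with `f' ⊥ mul T`. -/
noncomputable def opPart (T : Submodule ℂ (E × F)) : Submodule ℂ (E × F) :=
  T ⊓ (mul T)ᗮ.comap (LinearMap.snd ℂ E F)

theorem mem_opPart {T : Submodule ℂ (E × F)} {f : E} {f' : F} :
    (f, f') ∈ opPart T ↔ (f, f') ∈ T ∧ f' ∈ (mul T)ᗮ :=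
  Iff.rfl

open scoped ComplexOrder in
/-- A nonnegative selfadjoint relation: `K* = K`, and `⟪f', f⟫` is real and nonnegative for every
`(f, f') ∈ K`. -/
def IsNonnegSelfAdjoint [CompleteSpace E] (K : Submodule ℂ (E × E)) : Prop :=
  K.adjoint = K ∧ ∀ f f' : E, (f, f') ∈ K → 0 ≤ inner ℂ f f'

/-- `K` is a square root of the relation `H`: a nonnegative selfadjoint relation with `K² = H`.
(For nonnegative selfadjoint `H` such a `K` exists and is unique.) -/
def IsSqrt [CompleteSpace E] (K H : Submodule ℂ (E × E)) : Prop :=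
  IsNonnegSelfAdjoint K ∧ prod K K = H

/-- The order `H₁ ≤ H₂` of nonnegative selfadjoint relations: with `K₁ = H₁^{1/2}` and
`K₂ = H₂^{1/2}`, one has `dom (K₂)_s ⊆ dom (K₁)_s` and `‖(K₁)_s h‖ ≤ ‖(K₂)_s h‖` for all
`h ∈ dom (K₂)_s`. -/
def NonnegLE [CompleteSpace E] (H₁ H₂ : Submodule ℂ (E × E)) : Prop :=
  IsNonnegSelfAdjoint H₁ ∧ IsNonnegSelfAdjoint H₂ ∧
  ∃ K₁ K₂ : Submodule ℂ (E × E), IsSqrt K₁ H₁ ∧ IsSqrt K₂ H₂ ∧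
    dom (opPart K₂) ≤ dom (opPart K₁) ∧
    ∀ h k₁ k₂ : E, (h, k₁) ∈ opPart K₁ → (h, k₂) ∈ opPart K₂ → ‖k₁‖ ≤ ‖k₂‖

end Hilbert

end LinRel

/-! If `(x, y) ∈ T` and `(y, g) ∈ T*`, then `⟪x, g⟫ = ‖y‖²`, so `T* T` alone determines the norms on
`core T`; the core is graph-dense in the operator part of a closed `T`. Hence `T* T = S* S` forces
the operator parts to have equal domains and norms (`exists_opPart_of_adjoint_prod_eq`). A square
root `K` of `T* T` satisfies `K* K = T* T`, so square roots drop out of the order: `S* S ≤ T* T`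
means that each `(x, y)` in the operator part of `T` has a partner `(x, z)` in that of `S` with `‖z‖
≤ ‖y‖` (`nonnegLE_adjoint_prod_iff`). The map `y ↦ z` is then a contraction, as in Douglas
factorization. Extended by continuity, and by zero on the orthogonal complement, it kills `mul T`
and gives `Z T ⊆ S` (`exists_contraction_prod_le_iff`). Rescaling `T` covers `c > 0`; the case `c =
0` is separate. -/

namespace LinRel

/-! ### Operator parts, contractions between ranges, cores and scaling. -/

section Basic

variable {E F G : Type*} [NormedAddCommGroup E] [InnerProductSpace ℂ E]
  [NormedAddCommGroup F] [InnerProductSpace ℂ F] [NormedAddCommGroup G] [InnerProductSpace ℂ G]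

theorem mem_adjoint {T : Submodule ℂ (E × F)} {g : F} {h : E} :
    (g, h) ∈ T.adjoint ↔ ∀ a b, (a, b) ∈ T → inner ℂ b g = inner ℂ a h := by
  simp only [Submodule.mem_adjoint_iff, sub_eq_zero]

theorem isClosed_adjoint (T : Submodule ℂ (E × F)) :
    IsClosed (T.adjoint : Set (F × E)) := by
  have : (T.adjoint : Set (F × E)) =
      ⋂ p ∈ T, {q : F × E | inner ℂ (p : E × F).2 q.1 = inner ℂ p.1 q.2} := by
    ext ⟨g, h⟩
    simp [sub_eq_zero]
  rw [this]
  exact isClosed_biInter fun p _ => isClosed_eq (by fun_prop) (by fun_prop)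

theorem isClosed_mul {T : Submodule ℂ (E × F)} (hT : IsClosed (T : Set (E × F))) :
    IsClosed (mul T : Set F) :=
  hT.preimage (f := fun y : F => ((0 : E), y)) (by fun_prop)

theorem isClosed_opPart {T : Submodule ℂ (E × F)} (hT : IsClosed (T : Set (E × F))) :
    IsClosed (opPart T : Set (E × F)) :=
  hT.inter ((mul T).isClosed_orthogonal.preimage continuous_snd)

/-- The operator part is single valued. -/
theorem opPart_unique {T : Submodule ℂ (E × F)} {x : E} {y z : F} (hy : (x, y) ∈ opPart T)
    (hz : (x, z) ∈ opPart T) : y = z := by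
  have h := (opPart T).sub_mem hy hz
  rw [Prod.mk_sub_mk, sub_self, mem_opPart] at h
  exact sub_eq_zero.1 (inner_self_eq_zero.1 (h.2 _ h.1))

/-- Every element of a closed relation splits into an element of the operator part and an element
of the multivalued part. -/
theorem exists_mem_opPart [CompleteSpace F] {T : Submodule ℂ (E × F)}
    (hT : IsClosed (T : Set (E × F))) {x : E} {y : F} (h : (x, y) ∈ T) :
    ∃ z, (x, z) ∈ opPart T ∧ y - z ∈ mul T ∧ ‖z‖ ≤ ‖y‖ := by
  have : CompleteSpace (mul T) := (isClosed_mul hT).completeSpace_coe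
  refine ⟨(mul T)ᗮ.starProjection y, ⟨?_, Submodule.starProjection_apply_mem (mul T)ᗮ y⟩, ?_,
    Submodule.norm_starProjection_apply_le _ _⟩
  · have h0 : ((0 : E), (mul T).starProjection y) ∈ T :=
      Submodule.starProjection_apply_mem (mul T) y
    simpa [Submodule.starProjection_orthogonal'] using T.sub_mem h h0
  · simp [Submodule.starProjection_orthogonal']

/-- Orthogonal projection onto a closed relation, with respect to the Hilbert sum of `E` and
`F`. -/
theorem exists_projection [CompleteSpace E] [CompleteSpace F] {T : Submodule ℂ (E × F)}
    (hT : IsClosed (T : Set (E × F))) (x : E) (y : F) :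
    ∃ u v, (u, v) ∈ T ∧ ∀ a b, (a, b) ∈ T → inner ℂ a (x - u) + inner ℂ b (y - v) = 0 := by
  -- `E × F` carries the sup norm; orthogonal projection needs the Hilbert norm of `WithLp 2`.
  let Q : Submodule ℂ (WithLp 2 (E × F)) :=
    T.comap (WithLp.linearEquiv 2 ℂ (E × F) : WithLp 2 (E × F) →ₗ[ℂ] E × F)
  have hQ : IsClosed (Q : Set (WithLp 2 (E × F))) :=
    hT.preimage (WithLp.prod_continuous_ofLp 2 E F)
  have : CompleteSpace Q := hQ.completeSpace_coe
  let p := Q.starProjection (WithLp.toLp 2 (x, y))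
  refine ⟨p.fst, p.snd, Submodule.starProjection_apply_mem Q _, fun a b hab => ?_⟩
  have := Submodule.sub_starProjection_mem_orthogonal (K := Q) (WithLp.toLp 2 (x, y))
    (WithLp.toLp 2 (a, b)) hab
  rwa [WithLp.prod_inner_apply] at this

/-- A norm-decreasing correspondence between the ranges of two relations extends to a
contraction vanishing on the orthogonal complement of the first range. -/
theorem exists_contraction [CompleteSpace F] [CompleteSpace G] (S : Submodule ℂ (E × F))
    (T : Submodule ℂ (E × G)) (h : ∀ x y z, (x, y) ∈ S → (x, z) ∈ T → ‖z‖ ≤ ‖y‖) :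
    ∃ Z : F →L[ℂ] G, ‖Z‖ ≤ 1 ∧ (∀ x y z, (x, y) ∈ S → (x, z) ∈ T → Z y = z) ∧
      ∀ m, (∀ x y, (x, y) ∈ S → inner ℂ y m = 0) → Z m = 0 := by
  -- `W` is `T S⁻¹`. The norm bound says that its second coordinate `f` is dominated by its first,
  -- `e`, so `f` extends along `e` to the closure of `dom W`.
  let W : Submodule ℂ (F × G) :=
    prod T (S.map (LinearEquiv.prodComm ℂ E F : E × F →ₗ[ℂ] F × E))
  have hW : ∀ y z, (y, z) ∈ W ↔ ∃ x, (x, y) ∈ S ∧ (x, z) ∈ T := by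
    intro y z
    simp [W, mem_prod]
  let M : Submodule ℂ F := (dom W).topologicalClosure
  have : CompleteSpace M := (dom W).isClosed_topologicalClosure.completeSpace_coe
  have hfst : ∀ w : W, (w : F × G).1 ∈ dom W := fun w => mem_dom.2 ⟨_, w.2⟩
  let e : W →ₗ[ℂ] M := ((LinearMap.fst ℂ F G).comp W.subtype).codRestrict M
    fun w => (dom W).le_topologicalClosure (hfst w)
  let f : W →ₗ[ℂ] G := (LinearMap.snd ℂ F G).comp W.subtype
  have he : DenseRange e := by
    rintro ⟨m, hm⟩
    rw [closure_subtype]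
    refine closure_mono ?_ hm
    intro y hy
    obtain ⟨z, hz⟩ := mem_dom.1 hy
    exact ⟨e ⟨(y, z), hz⟩, ⟨_, rfl⟩, rfl⟩
  have hfe : ∀ w, ‖f w‖ ≤ 1 * ‖e w‖ := by
    rintro ⟨⟨y, z⟩, hw⟩
    obtain ⟨x, h₁, h₂⟩ := (hW y z).1 hw
    rw [one_mul]
    exact h x y z h₁ h₂
  let Z₀ : M →L[ℂ] G := f.extendOfNorm e
  have hZ₀ : ∀ m, ‖Z₀ m‖ ≤ 1 * ‖m‖ := LinearMap.norm_extendOfNorm_apply_le he 1 hfe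
  refine ⟨Z₀.comp M.orthogonalProjectionOnto, ?_, ?_, ?_⟩
  · refine ContinuousLinearMap.opNorm_le_bound _ zero_le_one fun y => (hZ₀ _).trans ?_
    simpa using Submodule.norm_orthogonalProjectionOnto_apply_le M y
  · intro x y z h₁ h₂
    have hw : (y, z) ∈ W := (hW y z).2 ⟨x, h₁, h₂⟩
    have : M.orthogonalProjectionOnto y = e ⟨(y, z), hw⟩ :=
      Submodule.orthogonalProjectionOnto_mem_subspace_eq_self (e ⟨(y, z), hw⟩)
    rw [ContinuousLinearMap.comp_apply, this]
    exact LinearMap.extendOfNorm_eq he ⟨1, hfe⟩ _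
  · intro m hm
    have : m ∈ Mᗮ := by
      rw [Submodule.orthogonal_closure, Submodule.mem_orthogonal]
      intro y hy
      obtain ⟨z, hz⟩ := mem_dom.1 hy
      obtain ⟨x, h₁, -⟩ := (hW y z).1 hz
      exact hm x y h₁
    rw [ContinuousLinearMap.comp_apply,
      Submodule.orthogonalProjectionOnto_apply_of_mem_orthogonal this, map_zero]

/-- The restriction of `T` to the elements `(f, f')` with `f' ∈ dom T*`, which is the part of `T`
seen by `T* T`. -/
noncomputable def core (T : Submodule ℂ (E × F)) : Submodule ℂ (E × F) :=
  T ⊓ (dom T.adjoint).comap (LinearMap.snd ℂ E F)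

theorem mem_core {T : Submodule ℂ (E × F)} {x : E} {y : F} :
    (x, y) ∈ core T ↔ (x, y) ∈ T ∧ ∃ g, (y, g) ∈ T.adjoint :=
  and_congr Iff.rfl mem_dom

/-- Testing an element of `T*` against `(0, m) ∈ T` shows `dom T* ⊥ mul T`. -/
theorem core_le_opPart (T : Submodule ℂ (E × F)) : core T ≤ opPart T := by
  rintro ⟨x, y⟩ h
  obtain ⟨h, g, hg⟩ := mem_core.1 h
  refine ⟨h, fun m hm => ?_⟩
  simpa using mem_adjoint.1 hg 0 m hm

theorem inner_of_mem_adjoint {T : Submodule ℂ (E × F)} {x g : E} {y : F} (h : (x, y) ∈ T)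
    (hg : (y, g) ∈ T.adjoint) : inner ℂ x g = (‖y‖ : ℂ) ^ 2 := by
  rw [← mem_adjoint.1 hg x y h, inner_self_eq_norm_sq_to_K]
  rfl

/-- A selfadjoint relation contained in the zero operator is the zero operator. -/
theorem scale_zero_eq {N : Submodule ℂ (E × E)} (h : (scale 0 N).adjoint = scale 0 N) :
    scale 0 N = (⊤ : Submodule ℂ E).prod ⊥ := by
  have h0 : ∀ x y, (x, y) ∈ scale 0 N → y = 0 := by
    intro x y hxy
    obtain ⟨z, -, rfl⟩ := mem_scale.1 hxy
    simp
  ext ⟨x, y⟩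
  simp only [Submodule.mem_prod, Submodule.mem_top, true_and, Submodule.mem_bot]
  refine ⟨h0 x y, ?_⟩
  -- The adjoint condition at `(x, 0)` reads `0 = 0`, so selfadjointness forces the domain to be
  -- everything.
  rintro rfl
  rw [← h, mem_adjoint]
  intro a b hab
  simp [h0 a b hab]

/-- Writes the zero operator in the form `T* T`, so that the factorization theorem applies to it
when `c = 0`. -/
theorem prod_adjoint_top_prod_bot :
    prod ((⊤ : Submodule ℂ E).prod (⊥ : Submodule ℂ F)).adjoint ((⊤ : Submodule ℂ E).prod ⊥) =
      (⊤ : Submodule ℂ E).prod ⊥ := by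
  ext ⟨x, y⟩
  simp only [mem_prod, mem_adjoint, Submodule.mem_prod, Submodule.mem_top, true_and,
    Submodule.mem_bot]
  constructor
  · rintro ⟨φ, rfl, h⟩
    have := h y 0 rfl
    rwa [inner_zero_left, eq_comm, inner_self_eq_zero] at this
  · rintro rfl
    exact ⟨0, rfl, by simp⟩

theorem isClosed_scale {c : ℝ} (hc : c ≠ 0) {T : Submodule ℂ (E × F)}
    (hT : IsClosed (T : Set (E × F))) : IsClosed (scale c T : Set (E × F)) := by
  have hc' : (c : ℂ) ≠ 0 := by exact_mod_cast hc
  have : (scale c T : Set (E × F)) = (fun p : E × F => (p.1, (c : ℂ)⁻¹ • p.2)) ⁻¹' T := by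
    ext ⟨x, y⟩
    rw [SetLike.mem_coe, mem_scale, Set.mem_preimage, SetLike.mem_coe]
    constructor
    · rintro ⟨z, hz, rfl⟩
      rwa [inv_smul_smul₀ hc']
    · exact fun h => ⟨_, h, smul_inv_smul₀ hc' y⟩
  rw [this]
  exact hT.preimage (by fun_prop)

/-- Absorbs the constant into the relation, which reduces the bound `c` to the bound `1`. -/
theorem scale_sq_adjoint_prod {c : ℝ} (hc : c ≠ 0) (T : Submodule ℂ (E × F)) :
    scale (c ^ 2) (prod T.adjoint T) = prod (scale c T).adjoint (scale c T) := by
  have hc' : (c : ℂ) ≠ 0 := by exact_mod_cast hc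
  have hadj : ∀ y g, ((c : ℂ) • y, ((c ^ 2 : ℝ) : ℂ) • g) ∈ (scale c T).adjoint ↔
      (y, g) ∈ T.adjoint := by
    intro y g
    rw [mem_adjoint, mem_adjoint]
    have hc2 : (c : ℂ) ^ 2 ≠ 0 := pow_ne_zero 2 hc'
    constructor
    · intro h u v huv
      have := h u _ (mem_scale.2 ⟨v, huv, rfl⟩)
      simpa [inner_smul_left, inner_smul_right, ← mul_assoc, ← sq, hc2] using this
    · intro h u w hw
      obtain ⟨v, huv, rfl⟩ := mem_scale.1 hw
      simp [← mul_assoc, ← sq, h u v huv]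
  ext ⟨x, g⟩
  rw [mem_scale, mem_prod]
  constructor
  · rintro ⟨g, ⟨y, hy, hg⟩, rfl⟩
    exact ⟨(c : ℂ) • y, mem_scale.2 ⟨y, hy, rfl⟩, (hadj y g).2 hg⟩
  · rintro ⟨z, hz, hg⟩
    obtain ⟨y, hy, rfl⟩ := mem_scale.1 hz
    have hg' : ((c ^ 2 : ℝ) : ℂ) • (((c ^ 2 : ℝ) : ℂ)⁻¹ • g) = g :=
      smul_inv_smul₀ (by exact_mod_cast pow_ne_zero 2 hc) g
    rw [← hg'] at hg
    exact ⟨_, ⟨y, hy, (hadj _ _).1 hg⟩, hg'⟩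

end Basic

/-! ### The relation `T* T`: surjectivity of `I + T* T`, cores, selfadjointness. -/

section Adjoint

variable {E F G : Type*} [NormedAddCommGroup E] [InnerProductSpace ℂ E] [CompleteSpace E]
  [NormedAddCommGroup F] [InnerProductSpace ℂ F] [CompleteSpace F]
  [NormedAddCommGroup G] [InnerProductSpace ℂ G] [CompleteSpace G]

/-- For closed `T` the relation `I + T* T` is surjective. -/
theorem exists_adjoint_prod_add {T : Submodule ℂ (E × F)} (hT : IsClosed (T : Set (E × F)))
    (x : E) : ∃ u v, (u, v) ∈ T ∧ (v, x - u) ∈ T.adjoint := by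
  -- The residual `(x - u, -v)` is orthogonal to `T`, which says exactly that `(v, x - u) ∈ T*`.
  obtain ⟨u, v, h, hp⟩ := exists_projection hT x 0
  refine ⟨u, v, h, mem_adjoint.2 fun a b hab => ?_⟩
  have := hp a b hab
  rw [zero_sub, inner_neg_right, add_neg_eq_zero] at this
  exact this.symm

/-- The core of a closed relation is dense in its operator part. -/
theorem opPart_le_of_core_le {T Q : Submodule ℂ (E × F)} (hT : IsClosed (T : Set (E × F)))
    (hQ : IsClosed (Q : Set (E × F))) (hQT : Q ≤ opPart T) (hcore : core T ≤ Q) :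
    opPart T ≤ Q := by
  rintro ⟨x, y⟩ h
  obtain ⟨u, v, huv, hp⟩ := exists_projection hQ x y
  have hd := (opPart T).sub_mem h (hQT huv)
  rw [Prod.mk_sub_mk] at hd
  -- The residual `(x - u, y - v)` is orthogonal to the core element `(a, b)`; since `(b, x - u - a)
  -- ∈ T*`, that inner product is `‖x - u‖²`. Then `y - v` lies in `mul T` and in its complement.
  obtain ⟨a, b, hab, hb⟩ := exists_adjoint_prod_add hT (x - u)
  have h1 := hp a b (hcore (mem_core.2 ⟨hab, _, hb⟩))
  have h2 := mem_adjoint.1 hb _ _ hd.1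
  have h3 : inner ℂ (x - u) (x - u) = (0 : ℂ) := by
    have h4 := congrArg (starRingEnd ℂ) h1
    simp only [map_add, inner_conj_symm, map_zero] at h4
    rw [h2, ← inner_add_right, add_sub_cancel] at h4
    exact h4
  rw [inner_self_eq_zero] at h3
  rw [h3] at hd
  have h5 : y - v = 0 := inner_self_eq_zero.1 (hd.2 _ hd.1)
  rw [sub_eq_zero.1 h3, sub_eq_zero.1 h5]
  exact huv

/-- If `T* T = S* S`, then the domain of `T` is contained in that of `S` and the operator part of
`S` is dominated by that of `T`. -/
theorem exists_opPart_of_adjoint_prod_eq {T : Submodule ℂ (E × F)} {S : Submodule ℂ (E × G)}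
    (hT : IsClosed (T : Set (E × F))) (hS : IsClosed (S : Set (E × G)))
    (h : prod T.adjoint T = prod S.adjoint S) {x : E} {y : F} (hxy : (x, y) ∈ opPart T) :
    ∃ z, (x, z) ∈ opPart S ∧ ‖z‖ ≤ ‖y‖ := by
  have key : ∀ x y, (x, y) ∈ core T → ∃ z, (x, z) ∈ core S ∧ ‖z‖ = ‖y‖ := by
    intro x y hxy
    obtain ⟨h₁, g, hg⟩ := mem_core.1 hxy
    have hm : (x, g) ∈ prod T.adjoint T := ⟨y, h₁, hg⟩
    rw [h] at hm
    obtain ⟨z, hz, hzg⟩ := hm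
    refine ⟨z, mem_core.2 ⟨hz, g, hzg⟩, ?_⟩
    have := (inner_of_mem_adjoint hz hzg).symm.trans (inner_of_mem_adjoint h₁ hg)
    norm_cast at this
    exact (sq_eq_sq₀ (norm_nonneg _) (norm_nonneg _)).1 this
  obtain ⟨Z, hZ, hZc, -⟩ := exists_contraction (core T) (core S) (by
    intro x y z hy hz
    obtain ⟨z', hz', hn⟩ := key x y hy
    rw [opPart_unique (core_le_opPart S hz) (core_le_opPart S hz')]
    exact hn.le)
  -- The pairs that `Z` carries into `S` form a closed set containing the core, hence exhaust the
  -- operator part.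
  let Q : Submodule ℂ (E × F) :=
    opPart T ⊓ S.comap (LinearMap.prodMap LinearMap.id (Z : F →ₗ[ℂ] G))
  have hQ : IsClosed (Q : Set (E × F)) :=
    (isClosed_opPart hT).inter (hS.preimage (f := fun p : E × F => (p.1, Z p.2)) (by fun_prop))
  have hmem := opPart_le_of_core_le hT hQ inf_le_left (by
    rintro ⟨x, y⟩ hxy
    refine ⟨core_le_opPart T hxy, ?_⟩
    obtain ⟨z, hz, -⟩ := key x y hxy
    change (x, Z y) ∈ S
    rw [hZc x y z hxy hz]
    exact (mem_core.1 hz).1) hxy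
  obtain ⟨z, hz, -, hn⟩ := exists_mem_opPart hS (x := x) (y := Z y) hmem.2
  exact ⟨z, hz, hn.trans (by simpa using Z.le_of_opNorm_le hZ y)⟩

open scoped ComplexOrder in
/-- Von Neumann's theorem: `T* T` is nonnegative selfadjoint for closed `T`. -/
theorem isNonnegSelfAdjoint_adjoint_prod {T : Submodule ℂ (E × F)}
    (hT : IsClosed (T : Set (E × F))) : IsNonnegSelfAdjoint (prod T.adjoint T) := by
  refine ⟨le_antisymm ?_ ?_, ?_⟩
  · rintro ⟨g, h⟩ hgh
    -- Here `u = (I + T* T)⁻¹ (g + h)` is the candidate for `g`. Testing `(g, h)` and `(u, g + h -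
    -- u)` against `(a, g - u - a)`, with `a = (I + T* T)⁻¹ (g - u)`, and subtracting yields `‖g -
    -- u‖² = 0`.
    obtain ⟨u, v, huv, hv⟩ := exists_adjoint_prod_add hT (g + h)
    obtain ⟨a, b, hab, hb⟩ := exists_adjoint_prod_add hT (g - u)
    have h1 := mem_adjoint.1 hgh a _ ⟨b, hab, hb⟩
    have h2 : inner ℂ (g - u - a) u = inner ℂ a (g + h - u) := by
      rw [← mem_adjoint.1 hv a b hab, ← inner_conj_symm, ← mem_adjoint.1 hb u v huv,
        inner_conj_symm]
    have h3 : inner ℂ (g - u) (g - u) = (0 : ℂ) := by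
      simp only [inner_sub_left, inner_sub_right, inner_add_right] at h1 h2 ⊢
      linear_combination h1 - h2
    obtain rfl : g = u := sub_eq_zero.1 (inner_self_eq_zero.1 h3)
    exact ⟨v, huv, by simpa using hv⟩
  · rintro ⟨g, h⟩ ⟨w, hw, hwh⟩
    refine mem_adjoint.2 ?_
    rintro a b ⟨c, hac, hcb⟩
    rw [← mem_adjoint.1 hwh a c hac, ← inner_conj_symm, ← mem_adjoint.1 hcb g w hw,
      inner_conj_symm]
  · rintro f f' ⟨w, hw, hwf⟩
    rw [inner_of_mem_adjoint hw hwf]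
    exact_mod_cast sq_nonneg ‖w‖

/-! ### Resolvent and square root of `T* T`. -/

open scoped ComplexOrder in
/-- The resolvent `(I + T* T)⁻¹` of a closed relation. -/
theorem exists_resolvent {T : Submodule ℂ (E × F)} (hT : IsClosed (T : Set (E × F))) :
    ∃ R : E →L[ℂ] E, 0 ≤ R ∧ R ≤ 1 ∧
      ∀ x y, (x, y) ∈ prod T.adjoint T ↔ ∃ z, R z = x ∧ z - R z = y := by
  set N := prod T.adjoint T
  have hpos : ∀ f f', (f, f') ∈ N → 0 ≤ inner ℂ f f' := (isNonnegSelfAdjoint_adjoint_prod hT).2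
  have hpos' : ∀ f f', (f, f') ∈ N → 0 ≤ inner ℂ f' f := fun f f' hf => by
    rw [← inner_conj_symm]
    exact star_nonneg_iff.2 (hpos f f' hf)
  have hsq : ∀ x : E, inner ℂ x x = ((‖x‖ ^ 2 : ℝ) : ℂ) := fun x => by
    rw [inner_self_eq_norm_sq_to_K]
    norm_cast
  have hex : ∀ x, ∃ u, (u, x - u) ∈ N := fun x => by
    obtain ⟨u, v, h₁, h₂⟩ := exists_adjoint_prod_add hT x
    exact ⟨u, v, h₁, h₂⟩
  -- Positivity of `⟪u, x - u⟫` gives `‖u‖² ≤ Re ⟪u, x⟫`. This bound yields both uniqueness and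
  -- continuity of the resolvent.
  have hle : ∀ x u, (u, x - u) ∈ N → ‖u‖ ≤ ‖x‖ := by
    intro x u hu
    have h := (Complex.nonneg_iff.1 (hpos _ _ hu)).1
    rw [inner_sub_right, hsq, Complex.sub_re, Complex.ofReal_re] at h
    have h' := re_inner_le_norm (𝕜 := ℂ) u x
    simp only [RCLike.re_to_complex] at h'
    nlinarith [norm_nonneg u, norm_nonneg x]
  have huniq : ∀ x u w, (u, x - u) ∈ N → (w, x - w) ∈ N → u = w := by
    intro x u w hu hw
    have h := N.sub_mem hu hw
    rw [Prod.mk_sub_mk, sub_sub_sub_cancel_left, ← neg_sub u w, ← zero_sub (u - w)] at h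
    simpa [sub_eq_zero] using hle _ _ h
  choose r hr using hex
  let R : E →L[ℂ] E := LinearMap.mkContinuous
    { toFun := r
      map_add' := fun x y => huniq _ _ _ (hr _) (by
        simpa [add_sub_add_comm] using N.add_mem (hr x) (hr y))
      map_smul' := fun a x => huniq _ _ _ (hr _) (by
        simpa [smul_sub] using N.smul_mem a (hr x)) } 1
    fun x => by simpa using hle _ _ (hr x)
  have hR : ∀ x, (R x, x - R x) ∈ N := hr
  have hpositive : ∀ S : E →L[ℂ] E, (∀ x, 0 ≤ inner ℂ (S x) x) → 0 ≤ S := by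
    intro S hS
    rw [ContinuousLinearMap.nonneg_iff_isPositive, ContinuousLinearMap.isPositive_iff_complex]
    intro x
    have := Complex.nonneg_iff.1 (hS x)
    exact ⟨Complex.ext (by simp) (by simpa using this.2), this.1⟩
  refine ⟨R, hpositive R fun x => ?_, sub_nonneg.1 (hpositive _ fun x => ?_), fun x y => ⟨?_, ?_⟩⟩
  · have : inner ℂ (R x) x = inner ℂ (R x) (R x) + inner ℂ (R x) (x - R x) := by
      rw [← inner_add_right, add_sub_cancel]
    rw [this, hsq]
    exact add_nonneg (by exact_mod_cast sq_nonneg ‖R x‖) (hpos _ _ (hR x))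
  · have : inner ℂ ((1 - R) x) x =
        inner ℂ (x - R x) (R x) + inner ℂ (x - R x) (x - R x) := by
      rw [← inner_add_right, add_sub_cancel]
      rfl
    rw [this, hsq]
    exact add_nonneg (hpos' _ _ (hR x)) (by exact_mod_cast sq_nonneg ‖x - R x‖)
  · intro h
    have : R (x + y) = x := huniq _ _ _ (hR _) (by simpa using h)
    exact ⟨x + y, this, by rw [this, add_sub_cancel_left]⟩
  · rintro ⟨z, rfl, rfl⟩
    exact hR z

open scoped ComplexOrder in
/-- `T* T` has a square root: with `R = (I + T* T)⁻¹`, it is the relation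
`{(R^{1/2} x, (I - R)^{1/2} x)}`. -/
theorem exists_isSqrt_adjoint_prod {T : Submodule ℂ (E × F)}
    (hT : IsClosed (T : Set (E × F))) : ∃ K, IsSqrt K (prod T.adjoint T) := by
  obtain ⟨R, hR0, hR1, hR⟩ := exists_resolvent hT
  have hR1' : 0 ≤ 1 - R := sub_nonneg.2 hR1
  set a := CFC.sqrt R
  set b := CFC.sqrt (1 - R)
  have ha : 0 ≤ a := CFC.sqrt_nonneg R
  have hb : 0 ≤ b := CFC.sqrt_nonneg (1 - R)
  have haa : a * a = R := CFC.sqrt_mul_sqrt_self R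
  have hbb : b * b = 1 - R := CFC.sqrt_mul_sqrt_self (1 - R)
  have hab : Commute a b := by
    have h₁ : Commute R (1 - R) := (Commute.one_right R).sub_right (Commute.refl R)
    have h₂ : Commute a (1 - R) := h₁.cfcₙ_nnreal NNReal.sqrt
    exact (h₂.symm.cfcₙ_nnreal NNReal.sqrt).symm
  have hab0 : 0 ≤ a * b := hab.mul_nonneg ha hb
  have haa' : ∀ x, a (a x) = R x := fun x => congrArg (· x) haa
  have hbb' : ∀ x, b (b x) = x - R x := fun x => congrArg (· x) hbb
  have hab' : ∀ x, a (b x) = b (a x) := fun x => congrArg (· x) hab.eq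
  have hsym : ∀ S : E →L[ℂ] E, 0 ≤ S → ∀ x y, inner ℂ (S x) y = inner ℂ x (S y) :=
    fun S hS => ((ContinuousLinearMap.nonneg_iff_isPositive S).1 hS).isSymmetric
  let K : Submodule ℂ (E × E) := LinearMap.range ((a : E →ₗ[ℂ] E).prod (b : E →ₗ[ℂ] E))
  have hK : ∀ x y, (x, y) ∈ K ↔ ∃ z, a z = x ∧ b z = y := fun x y => by
    simp [K, Prod.ext_iff]
  refine ⟨K, ⟨?_, ?_⟩, ?_⟩
  · ext ⟨g, h⟩
    have h₁ : (g, h) ∈ K.adjoint ↔ b g = a h := by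
      rw [mem_adjoint]
      constructor
      · intro H
        refine ext_inner_left ℂ fun z => ?_
        rw [← hsym b hb, ← hsym a ha]
        exact H _ _ ((hK _ _).2 ⟨z, rfl, rfl⟩)
      · rintro H x y hxy
        obtain ⟨z, rfl, rfl⟩ := (hK _ _).1 hxy
        rw [hsym b hb, hsym a ha, H]
    rw [h₁, hK]
    constructor
    · intro H
      -- Since `a² + b² = 1`, the map `(g, h) ↦ a g + b h` inverts `z ↦ (a z, b z)`.
      refine ⟨a g + b h, ?_, ?_⟩
      · rw [map_add, hab', ← H, haa', hbb', add_sub_cancel]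
      · rw [map_add, ← hab', H, haa', hbb', add_sub_cancel]
    · rintro ⟨z, rfl, rfl⟩
      exact (hab' z).symm
  · intro x y hxy
    obtain ⟨z, rfl, rfl⟩ := (hK _ _).1 hxy
    rw [hsym a ha]
    exact ((ContinuousLinearMap.nonneg_iff_isPositive _).1 hab0).inner_nonneg_right z
  · ext ⟨f, g⟩
    rw [hR, mem_prod]
    constructor
    · rintro ⟨φ, h₁, h₂⟩
      obtain ⟨x, rfl, rfl⟩ := (hK _ _).1 h₁
      obtain ⟨y, hy, rfl⟩ := (hK _ _).1 h₂
      -- The intermediate vector is `b x = a y`; with `a² + b² = 1` this gives `a z = x` and `b z =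
      -- y` after one more factor: `R z = a x` and `z - R z = b y`.
      refine ⟨a x + b y, ?_, ?_⟩
      · rw [← haa', map_add, hab' y, hy, haa', hbb', add_sub_cancel]
      · rw [← hbb', map_add, ← hab' x, ← hy, haa', hbb', add_sub_cancel]
    · rintro ⟨z, rfl, rfl⟩
      exact ⟨b (a z), (hK _ _).2 ⟨a z, haa' z, rfl⟩, (hK _ _).2 ⟨b z, hab' z, hbb' z⟩⟩

theorem IsSqrt.isClosed {K N : Submodule ℂ (E × E)} (h : IsSqrt K N) :
    IsClosed (K : Set (E × E)) :=
  h.1.1 ▸ isClosed_adjoint K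

/-- Brings square roots under the comparison of relations with equal `T* T`, so their uniqueness is
never needed. -/
theorem IsSqrt.adjoint_prod_eq {K N : Submodule ℂ (E × E)} (h : IsSqrt K N) :
    prod K.adjoint K = N := by
  rw [h.1.1, h.2]

/-! ### The order and factorization. -/

/-- The order on nonnegative selfadjoint relations `T* T`, expressed through operator parts. -/
theorem nonnegLE_adjoint_prod_iff {S : Submodule ℂ (E × F)} {T : Submodule ℂ (E × G)}
    (hS : IsClosed (S : Set (E × F))) (hT : IsClosed (T : Set (E × G))) :
    NonnegLE (prod S.adjoint S) (prod T.adjoint T) ↔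
      ∀ x y, (x, y) ∈ opPart T → ∃ z, (x, z) ∈ opPart S ∧ ‖z‖ ≤ ‖y‖ := by
  constructor
  · rintro ⟨-, -, K₁, K₂, h₁, h₂, hdom, hle⟩ x y hxy
    obtain ⟨k₂, hk₂, hn₂⟩ :=
      exists_opPart_of_adjoint_prod_eq hT h₂.isClosed h₂.adjoint_prod_eq.symm hxy
    obtain ⟨k₁, hk₁⟩ := mem_dom.1 (hdom (mem_dom.2 ⟨k₂, hk₂⟩))
    obtain ⟨z, hz, hn₁⟩ :=
      exists_opPart_of_adjoint_prod_eq h₁.isClosed hS h₁.adjoint_prod_eq hk₁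
    exact ⟨z, hz, hn₁.trans ((hle x k₁ k₂ hk₁ hk₂).trans hn₂)⟩
  · intro h
    obtain ⟨K₁, h₁⟩ := exists_isSqrt_adjoint_prod hS
    obtain ⟨K₂, h₂⟩ := exists_isSqrt_adjoint_prod hT
    have key : ∀ x k₂, (x, k₂) ∈ opPart K₂ → ∃ k₁, (x, k₁) ∈ opPart K₁ ∧ ‖k₁‖ ≤ ‖k₂‖ := by
      intro x k₂ hk₂
      obtain ⟨y, hy, hn₂⟩ :=
        exists_opPart_of_adjoint_prod_eq h₂.isClosed hT h₂.adjoint_prod_eq hk₂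
      obtain ⟨z, hz, hn⟩ := h x y hy
      obtain ⟨k₁, hk₁, hn₁⟩ :=
        exists_opPart_of_adjoint_prod_eq hS h₁.isClosed h₁.adjoint_prod_eq.symm hz
      exact ⟨k₁, hk₁, hn₁.trans (hn.trans hn₂)⟩
    refine ⟨isNonnegSelfAdjoint_adjoint_prod hS, isNonnegSelfAdjoint_adjoint_prod hT, K₁, K₂,
      h₁, h₂, ?_, ?_⟩
    · intro x hx
      obtain ⟨k₂, hk₂⟩ := mem_dom.1 hx
      obtain ⟨k₁, hk₁, -⟩ := key x k₂ hk₂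
      exact mem_dom.2 ⟨k₁, hk₁⟩
    · intro x k₁ k₂ hk₁ hk₂
      obtain ⟨k, hk, hn⟩ := key x k₂ hk₂
      rwa [opPart_unique hk₁ hk]

/-- Factorization through a contraction. -/
theorem exists_contraction_prod_le_iff {S : Submodule ℂ (E × F)} {T : Submodule ℂ (E × G)}
    (hS : IsClosed (S : Set (E × F))) (hT : IsClosed (T : Set (E × G))) :
    (∃ Z : G →L[ℂ] F, ‖Z‖ ≤ 1 ∧ prod (Z : G →ₗ[ℂ] F).graph T ≤ S) ↔
      NonnegLE (prod S.adjoint S) (prod T.adjoint T) := by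
  rw [nonnegLE_adjoint_prod_iff hS hT]
  constructor
  · rintro ⟨Z, hZ, h⟩ x y hxy
    obtain ⟨z, hz, -, hn⟩ := exists_mem_opPart hS (h (show (x, Z y) ∈ _ from ⟨y, hxy.1, rfl⟩))
    exact ⟨z, hz, hn.trans (by simpa using Z.le_of_opNorm_le hZ y)⟩
  · intro h
    obtain ⟨Z, hZ, hZe, hZ0⟩ := exists_contraction (opPart T) (opPart S) (by
      intro x y z hy hz
      obtain ⟨z', hz', hn⟩ := h x y hy
      rwa [opPart_unique hz hz'])
    refine ⟨Z, hZ, ?_⟩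
    rintro ⟨x, w⟩ ⟨y, hxy, hw⟩
    obtain rfl : w = Z y := hw
    obtain ⟨y₀, hy₀, hm, -⟩ := exists_mem_opPart hT hxy
    obtain ⟨z, hz, -⟩ := h x y₀ hy₀
    have h0 : Z (y - y₀) = 0 :=
      hZ0 _ fun _ y' hy' => (mul T).inner_left_of_mem_orthogonal hm hy'.2
    rw [map_sub, hZe x y₀ z hy₀ hz, sub_eq_zero] at h0
    rw [h0]
    exact hz.1

/-- Factorization with a prescribed positive norm bound. -/
theorem exists_norm_le_prod_le_iff {c : ℝ} (hc : 0 < c) {S : Submodule ℂ (E × F)}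
    {T : Submodule ℂ (E × G)} (hS : IsClosed (S : Set (E × F)))
    (hT : IsClosed (T : Set (E × G))) :
    (∃ Z : G →L[ℂ] F, ‖Z‖ ≤ c ∧ prod (Z : G →ₗ[ℂ] F).graph T ≤ S) ↔
      NonnegLE (prod S.adjoint S) (scale (c ^ 2) (prod T.adjoint T)) := by
  have hc' : (c : ℂ) ≠ 0 := by exact_mod_cast hc.ne'
  rw [scale_sq_adjoint_prod hc.ne',
    ← exists_contraction_prod_le_iff hS (isClosed_scale hc.ne' hT)]
  constructor
  · rintro ⟨Z, hZ, h⟩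
    refine ⟨(c : ℂ)⁻¹ • Z, ?_, ?_⟩
    · rw [norm_smul, norm_inv, Complex.norm_real, Real.norm_of_nonneg hc.le]
      exact inv_mul_le_one_of_le₀ hZ hc.le
    · rintro ⟨x, w⟩ ⟨y', hxy', hw⟩
      obtain ⟨y, hxy, rfl⟩ := mem_scale.1 hxy'
      obtain rfl : w = (c : ℂ)⁻¹ • Z ((c : ℂ) • y) := hw
      refine h ⟨y, hxy, ?_⟩
      change (c : ℂ)⁻¹ • Z ((c : ℂ) • y) = Z y
      rw [map_smul, inv_smul_smul₀ hc']
  · rintro ⟨Z, hZ, h⟩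
    refine ⟨(c : ℂ) • Z, ?_, ?_⟩
    · rw [norm_smul, Complex.norm_real, Real.norm_of_nonneg hc.le]
      exact mul_le_of_le_one_right hc.le hZ
    · rintro ⟨x, w⟩ ⟨y, hxy, hw⟩
      obtain rfl : w = ((c : ℂ) • Z) y := hw
      refine h ⟨(c : ℂ) • y, mem_scale.2 ⟨y, hxy, rfl⟩, ?_⟩
      simp [LinearMap.mem_graph_iff]

theorem top_prod_bot_le_of_nonnegLE {S : Submodule ℂ (E × F)} (hS : IsClosed (S : Set (E × F)))
    {N : Submodule ℂ (E × E)} (h : NonnegLE (prod S.adjoint S) (scale 0 N)) :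
    (⊤ : Submodule ℂ E).prod ⊥ ≤ S := by
  rw [scale_zero_eq h.2.1.1, ← prod_adjoint_top_prod_bot (F := E)] at h
  obtain ⟨Z, -, hZ⟩ := (exists_contraction_prod_le_iff hS (by
    rw [Submodule.prod_coe]
    exact isClosed_univ.prod isClosed_singleton)).2 h
  rintro ⟨x, y⟩ ⟨-, hy⟩
  obtain rfl : y = 0 := hy
  exact hZ ⟨0, ⟨trivial, rfl⟩, by simp⟩

end Adjoint

end LinRel

theorem theorem4p4 {H HA HB : Type*}
    [NormedAddCommGroup H] [InnerProductSpace ℂ H] [CompleteSpace H]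
    [NormedAddCommGroup HA] [InnerProductSpace ℂ HA] [CompleteSpace HA]
    [NormedAddCommGroup HB] [InnerProductSpace ℂ HB] [CompleteSpace HB]
    (A : Submodule ℂ (H × HA)) (hA : IsClosed (A : Set (H × HA)))
    (B : Submodule ℂ (H × HB)) (hB : IsClosed (B : Set (H × HB))) :
    ((∃ Z : HB →L[ℂ] HA, LinRel.prod (Z : HB →ₗ[ℂ] HA).graph B ≤ A) ↔
      ∃ c : ℝ, 0 ≤ c ∧ LinRel.NonnegLE (LinRel.prod A.adjoint A)
        (LinRel.scale (c ^ 2) (LinRel.prod B.adjoint B))) ∧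
    ∀ c : ℝ, 0 ≤ c →
      LinRel.NonnegLE (LinRel.prod A.adjoint A)
        (LinRel.scale (c ^ 2) (LinRel.prod B.adjoint B)) →
      ∃ Z : HB →L[ℂ] HA, ‖Z‖ ≤ c ∧ LinRel.prod (Z : HB →ₗ[ℂ] HA).graph B ≤ A := by
  have key : ∀ c : ℝ, 0 ≤ c →
      LinRel.NonnegLE (LinRel.prod A.adjoint A)
        (LinRel.scale (c ^ 2) (LinRel.prod B.adjoint B)) →
      ∃ Z : HB →L[ℂ] HA, ‖Z‖ ≤ c ∧ LinRel.prod (Z : HB →ₗ[ℂ] HA).graph B ≤ A := by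
    intro c hc h
    obtain rfl | hc := hc.eq_or_lt
    · rw [zero_pow two_ne_zero] at h
      refine ⟨0, by simp, ?_⟩
      rintro ⟨x, w⟩ ⟨y, -, hw⟩
      obtain rfl : w = 0 := hw
      exact LinRel.top_prod_bot_le_of_nonnegLE hA h ⟨trivial, rfl⟩
    · exact (LinRel.exists_norm_le_prod_le_iff hc hA hB).2 h
  refine ⟨⟨?_, ?_⟩, key⟩
  · rintro ⟨Z, hZ⟩
    have hc : 0 < ‖Z‖ + 1 := by positivity
    exact ⟨‖Z‖ + 1, hc.le,
      (LinRel.exists_norm_le_prod_le_iff hc hA hB).1 ⟨Z, by linarith, hZ⟩⟩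
  · rintro ⟨c, hc, h⟩
    obtain ⟨Z, -, hZ⟩ := key c hc h
    exact ⟨Z, hZ⟩
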